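/- Let $r>0$, $0<p<1$, and let $\mathrm{NB}(r,p)$ be the negative binomial distribution with mass function $\Pr(Z=k)=\frac{\Gamma(r+k)}{\Gamma(r)\,k!}(1-p)^r p^k$, $k=0,1,2,\dots$. For an integer $m\ge 0$ put $\mathbb Z_m=\{m,m+1,\dots\}$ and $\mathcal F_m=\{\mathbf 1_A: A\subset\mathbb Z_m\}$; for a random variable $X$ with $\Pr(X\ge m)>0$ let $X^{(m)}$ have the law $\mathcal L(X\mid X\ge m)$, and let $\mathrm{NB}^{(m)}(r,p)=\mathcal L(Z^{(m)})$ with $Z\sim \mathrm{NB}(r,p)$. For distributions $Q_1,Q_2$ on $\mathbb Z_m$ let $d_{TV}(Q_1,Q_2)=\sup_{f\in\mathcal F_m}\left|\int f\,dQ_1-\int f\,dQ_2\right|$. For a function $h$ write $\Delta h(w)=h(w+1)-h(w)$ and $\|h\|_m=\sup_{w\in\mathbb Z_m}|h(w+1)|$. For $g$ on $\mathbb Z_m$ let $$\mathbb B_m g(i)=p(r+i)g(i+1)-i\,g(i)\mathbf 1_{\{i>m\}},\qquad i\in\mathbb Z_m .$$ For $f\in\mathcal F_m$ let $g_{m,f}$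 be the solution on $\mathbb Z_m$ of $\mathbb B_m g(i)=f(i)-\mathbb E f(Z^{(m)})$, $i\in\mathbb Z_m$, which is unique except at $i=m$, normalised by $g_{m,f}(m)=0$, and put $$G_{m,1}=\sup_{f\in\mathcal F_m}\|g_{m,f}\|_m,\qquad G_{m,2}=\sup_{f\in\mathcal F_m}\ \sup_{w\in\mathbb Z_m}|\Delta g_{m,f}(w)| .$$ **Lemma.** Let $W$ be a random variable with values in $\{0,1,2,\dots\}$ and let $\epsilon_1,\epsilon_2>0$ be such that $$|\mathbb E\,\mathbb B_0 g(W)|\le \epsilon_1\|g\|_0+\epsilon_2\|\Delta g\|_0$$ for every function $g$ on $\mathbb Z_0$ for which $\|g\|_0$ and $\|\Delta g\|_0$ are finite and the expectation exists. Then, for every integer $m\ge 0$ with $\Pr(W\ge m)>0$, the quantities $G_{m,1}$ and $G_{m,2}$ are finite and $$d_{TV}\big(\mathcal L(W^{(m)}),\mathrm{NB}^{(m)}(r,p)\big)\le\frac{\epsilon_1G_{m,1}+\epsilon_2G_{m,2}}{\Pr(W\ge m)} .$$ For $m=0$ the bound also holds with $G_{0,2}$ replaced by $\sup_{f\in\mathcal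 F_0}\|\Delta g_{0,f}\|_0$, in which the difference at $w=0$ is left out. -/

import Mathlib

open MeasureTheory ProbabilityTheory
open scoped ENNReal

noncomputable section

namespace CondNB

/-- Mass function of the negative binomial distribution `NB(r, p)`:
`Γ(r + k) / (Γ(r) k!) * (1 - p)^r * p^k`. -/
def nbMass (r p : ℝ) (k : ℕ) : ℝ :=
  Real.Gamma (r + k) / (Real.Gamma r * (Nat.factorial k : ℝ)) * (1 - p) ^ r * p ^ k

/-- The negative binomial distribution `NB(r, p)` on `ℕ`. -/
def nb (r p : ℝ) : Measure ℕ :=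
  Measure.sum fun k : ℕ => ENNReal.ofReal (nbMass r p k) • Measure.dirac k

/-- `NB^{(m)}(r, p)`: the law of `Z ∼ NB(r, p)` conditioned on `Z ≥ m`. -/
def nbCond (r p : ℝ) (m : ℕ) : Measure ℕ :=
  ProbabilityTheory.cond (nb r p) (Set.Ici m)

/-- `ℒ(W^{(m)}) = ℒ(W | W ≥ m)`. -/
def condLaw {Ω : Type*} [MeasurableSpace Ω] (μ : Measure Ω) (W : Ω → ℕ) (m : ℕ) : Measure ℕ :=
  Measure.map W (ProbabilityTheory.cond μ {ω | m ≤ W ω})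

/-- `ℱ_m`: the indicator functions of the subsets of `ℤ_m = {m, m + 1, …}`. -/
def indicators (m : ℕ) : Set (ℕ → ℝ) :=
  {f | ∃ A : Set ℕ, A ⊆ Set.Ici m ∧ f = A.indicator 1}

/-- Total variation distance of two distributions on `ℤ_m`:
`sup_{f ∈ ℱ_m} |∫ f dQ₁ - ∫ f dQ₂|`. -/
def dTV (m : ℕ) (Q₁ Q₂ : Measure ℕ) : ℝ :=
  ⨆ f : indicators m, |∫ x, f.1 x ∂Q₁ - ∫ x, f.1 x ∂Q₂|

/-- The Stein operator `𝔹_m g (i) = p (r + i) g(i + 1) - i g(i) 1_{i > m}`. A function on `ℤ_m` is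
represented by a function on `ℕ`, whose values below `m` are irrelevant. -/
def steinOp (r p : ℝ) (m : ℕ) (g : ℕ → ℝ) (i : ℕ) : ℝ :=
  p * (r + i) * g (i + 1) - (if m < i then (i : ℝ) * g i else 0)

/-- Forward difference `Δ h (w) = h(w + 1) - h(w)`. -/
def delta (h : ℕ → ℝ) (w : ℕ) : ℝ := h (w + 1) - h w

/-- `‖h‖_m = sup_{w ∈ ℤ_m} |h(w + 1)|`, with values in `[0, ∞]`. -/
def shiftNorm (m : ℕ) (h : ℕ → ℝ) : ℝ≥0∞ :=
  ⨆ w ∈ Set.Ici m, ‖h (w + 1)‖ₑ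

/-- The solution `g_{m,f}` of the Stein equation `𝔹_m g (i) = f(i) - NB^{(m)}(r, p){f}`, `i ≥ m`,
normalised by `g(m) = 0` (the equation does not involve `g(m)` and determines all later values). -/
def steinSol (r p : ℝ) (m : ℕ) (f : ℕ → ℝ) : ℕ → ℝ
  | 0 => 0
  | i + 1 =>
    if i < m then 0
    else (f i - (∫ x, f x ∂(nbCond r p m)) + (if m < i then (i : ℝ) * steinSol r p m f i else 0))
      / (p * (r + i))

theorem steinSol_eq_zero (r p : ℝ) (m : ℕ) (f : ℕ → ℝ) {i : ℕ} (hi : i ≤ m) :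
    steinSol r p m f i = 0 := by
  cases i with
  | zero => simp [steinSol]
  | succ i => simp [steinSol, Nat.lt_of_succ_le hi]

/-- `steinSol` solves the Stein equation on `ℤ_m`. -/
theorem steinOp_steinSol {r p : ℝ} (hr : 0 < r) (hp : 0 < p) (m : ℕ) (f : ℕ → ℝ) {i : ℕ}
    (hi : m ≤ i) :
    steinOp r p m (steinSol r p m f) i = f i - ∫ x, f x ∂(nbCond r p m) := by
  have h : p * (r + i) ≠ 0 := by positivity
  rw [steinOp, steinSol, if_neg (not_lt.mpr hi), mul_div_cancel₀ _ h]
  ring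

/-- Any solution of the Stein equation on `ℤ_m` agrees with `steinSol` beyond `m`. -/
theorem eq_steinSol {r p : ℝ} (hr : 0 < r) (hp : 0 < p) (m : ℕ) (f g : ℕ → ℝ)
    (hg : ∀ i, m ≤ i → steinOp r p m g i = f i - ∫ x, f x ∂(nbCond r p m)) (i : ℕ) (hi : m < i) :
    g i = steinSol r p m f i := by
  induction i with
  | zero => omega
  | succ i ih =>
    have h : p * (r + i) ≠ 0 := by positivity
    have h1 := hg i (by omega)
    rw [← steinOp_steinSol hr hp m f (by omega : m ≤ i), steinOp, steinOp] at h1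
    by_cases hm : m < i
    · rw [if_pos hm, if_pos hm, ih hm] at h1
      exact mul_left_cancel₀ h (by linarith)
    · rw [if_neg hm, if_neg hm] at h1
      exact mul_left_cancel₀ h (by linarith)

/-- `G_{m,1} = sup_{f ∈ ℱ_m} ‖g_{m,f}‖_m`. -/
def steinFactor₁ (r p : ℝ) (m : ℕ) : ℝ≥0∞ :=
  ⨆ f ∈ indicators m, shiftNorm m (steinSol r p m f)

/-- `G_{m,2} = sup_{f ∈ ℱ_m} sup_{w ∈ ℤ_m} |Δ g_{m,f}(w)|`, where `g_{m,f}(m) = 0`. The supremum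
includes the difference at `w = m`. -/
def steinFactor₂ (r p : ℝ) (m : ℕ) : ℝ≥0∞ :=
  ⨆ f ∈ indicators m, ⨆ w ∈ Set.Ici m, ‖delta (steinSol r p m f) w‖ₑ

/-- `sup_{f ∈ ℱ_m} ‖Δ g_{m,f}‖_m`, that is `G_{m,2}` without the difference at `w = m`. -/
def steinFactor₂' (r p : ℝ) (m : ℕ) : ℝ≥0∞ :=
  ⨆ f ∈ indicators m, shiftNorm m (delta (steinSol r p m f))

end CondNB

end

namespace CondNB

open Filter Topology

/-! Let `g` be the truncated Stein solution for `f`, set to zero up to and including `m`. Because `g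
m = 0`, the cut-off in the operator is immaterial, and the untruncated operator applied to `g`
equals `f - E f(Z^(m))` on `[m, ∞)` and `0` below (`steinOp_zero_steinSol`). Its expectation at `W`,
divided by `P(W ≥ m)`, is therefore the difference of the two conditional expectations of `f`
(`integral_condLaw_sub`), to which the hypothesis on `W` applies. Finiteness of the factors:
detailed balance turns the recursion into a tail sum (`mul_steinSol_add_setIntegral`), and the tails
are at most a constant times the mass (`exists_nb_real_Ici_le`). -/

/-! ### Mass function and tails of the negative binomial law. -/

theorem nbMass_pos {r p : ℝ} (hr : 0 < r) (hp0 : 0 < p) (hp1 : p < 1) (k : ℕ) :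
    0 < nbMass r p k := by
  have h1 : 0 < Real.Gamma (r + k) := Real.Gamma_pos_of_pos (by positivity)
  have h2 : 0 < Real.Gamma r := Real.Gamma_pos_of_pos hr
  have h3 : 0 < (1 - p) ^ r := Real.rpow_pos_of_pos (by linarith) r
  have h4 : (0 : ℝ) < Nat.factorial k := by exact_mod_cast Nat.factorial_pos k
  unfold nbMass
  positivity

/-- The detailed balance relation for the negative binomial mass function. -/
theorem succ_mul_nbMass_succ {r : ℝ} (hr : 0 < r) (p : ℝ) (k : ℕ) :
    ((k + 1 : ℕ) : ℝ) * nbMass r p (k + 1) = p * (r + k) * nbMass r p k := by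
  have h2 : Real.Gamma r ≠ 0 := (Real.Gamma_pos_of_pos hr).ne'
  have h4 : (Nat.factorial k : ℝ) ≠ 0 := by exact_mod_cast Nat.factorial_ne_zero k
  have h5 : (k : ℝ) + 1 ≠ 0 := by positivity
  have h6 : Real.Gamma (r + (k + 1 : ℕ)) = (r + k) * Real.Gamma (r + k) := by
    rw [← Real.Gamma_add_one (by positivity)]
    push_cast
    ring_nf
  unfold nbMass
  rw [h6, Nat.factorial_succ]
  push_cast
  field_simp
  ring

theorem nbMass_succ_div {r p : ℝ} (hr : 0 < r) (hp0 : 0 < p) (hp1 : p < 1) (k : ℕ) :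
    nbMass r p (k + 1) / nbMass r p k = p * (r + k) / (k + 1) := by
  have h := succ_mul_nbMass_succ hr p k
  have h1 := (nbMass_pos hr hp0 hp1 k).ne'
  have h5 : (k : ℝ) + 1 ≠ 0 := by positivity
  push_cast at h
  field_simp
  linarith

theorem tendsto_nbMass_succ_div {r p : ℝ} (hr : 0 < r) (hp0 : 0 < p) (hp1 : p < 1) :
    Tendsto (fun k => nbMass r p (k + 1) / nbMass r p k) atTop (𝓝 p) := by
  have h : Tendsto (fun k : ℕ => p + p * (r - 1) * (1 / ((k : ℝ) + 1))) atTop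
      (𝓝 (p + p * (r - 1) * 0)) :=
    (tendsto_one_div_add_atTop_nhds_zero_nat.const_mul _).const_add _
  rw [mul_zero, add_zero] at h
  refine h.congr fun k => ?_
  rw [nbMass_succ_div hr hp0 hp1]
  have h5 : (k : ℝ) + 1 ≠ 0 := by positivity
  field_simp
  ring

theorem summable_nbMass {r p : ℝ} (hr : 0 < r) (hp0 : 0 < p) (hp1 : p < 1) :
    Summable (nbMass r p) := by
  refine summable_of_ratio_test_tendsto_lt_one hp1
    (Eventually.of_forall fun k => (nbMass_pos hr hp0 hp1 k).ne') ?_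
  refine (tendsto_nbMass_succ_div hr hp0 hp1).congr fun k => ?_
  rw [Real.norm_of_nonneg (nbMass_pos hr hp0 hp1 _).le,
    Real.norm_of_nonneg (nbMass_pos hr hp0 hp1 _).le]

theorem isFiniteMeasure_nb {r p : ℝ} (hr : 0 < r) (hp0 : 0 < p) (hp1 : p < 1) :
    IsFiniteMeasure (nb r p) := by
  refine ⟨?_⟩
  rw [nb, Measure.sum_apply _ MeasurableSet.univ]
  simpa using (summable_nbMass hr hp0 hp1).tsum_ofReal_lt_top

theorem nb_real_singleton {r p : ℝ} (hr : 0 < r) (hp0 : 0 < p) (hp1 : p < 1) (k : ℕ) :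
    (nb r p).real {k} = nbMass r p k := by
  rw [measureReal_def, nb, Measure.sum_apply _ (measurableSet_singleton k), tsum_eq_single k]
  · simp [(nbMass_pos hr hp0 hp1 k).le]
  · intro j hj
    simp [hj]

theorem Ici_eq_singleton_union (i : ℕ) : Set.Ici i = {i} ∪ Set.Ici (i + 1) := by
  ext j
  simp only [Set.mem_Ici, Set.mem_union, Set.mem_singleton_iff]
  omega

theorem disjoint_singleton_Ici_succ (i : ℕ) : Disjoint {i} (Set.Ici (i + 1)) := by
  simp

theorem nb_real_Ici {r p : ℝ} (hr : 0 < r) (hp0 : 0 < p) (hp1 : p < 1) (i : ℕ) :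
    (nb r p).real (Set.Ici i) = nbMass r p i + (nb r p).real (Set.Ici (i + 1)) := by
  have := isFiniteMeasure_nb hr hp0 hp1
  rw [Ici_eq_singleton_union i, measureReal_union (disjoint_singleton_Ici_succ i)
    measurableSet_Ici, nb_real_singleton hr hp0 hp1]

theorem tendsto_nb_real_Ici {r p : ℝ} (hr : 0 < r) (hp0 : 0 < p) (hp1 : p < 1) :
    Tendsto (fun i : ℕ => (nb r p).real (Set.Ici i)) atTop (𝓝 0) := by
  have := isFiniteMeasure_nb hr hp0 hp1
  have h : Tendsto (fun i : ℕ => nb r p (Set.Ici i)) atTop (𝓝 (nb r p (⋂ i, Set.Ici i))) :=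
    tendsto_measure_iInter_atTop (fun i => measurableSet_Ici.nullMeasurableSet)
      (fun i j hij => Set.Ici_subset_Ici.mpr hij) ⟨0, measure_ne_top _ _⟩
  have he : (⋂ i : ℕ, Set.Ici i) = ∅ := by
    ext j
    simp only [Set.mem_iInter, Set.mem_Ici, Set.mem_empty_iff_false, iff_false, not_forall]
    exact ⟨j + 1, by omega⟩
  rw [he, measure_empty] at h
  simpa [measureReal_def, Function.comp_def] using (ENNReal.tendsto_toReal ENNReal.zero_ne_top).comp h

/-- The upper tails of the negative binomial distribution are bounded by a multiple of the mass
function. -/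
theorem exists_nb_real_Ici_le {r p : ℝ} (hr : 0 < r) (hp0 : 0 < p) (hp1 : p < 1) :
    ∃ C : ℝ, ∀ i : ℕ, (nb r p).real (Set.Ici i) ≤ C * nbMass r p i := by
  obtain ⟨q, hpq, hq1⟩ := exists_between hp1
  obtain ⟨N, hN⟩ := eventually_atTop.mp
    ((tendsto_nbMass_succ_div hr hp0 hp1).eventually (gt_mem_nhds hpq))
  have hpos := nbMass_pos hr hp0 hp1
  have hratio : ∀ i, N ≤ i → nbMass r p (i + 1) ≤ q * nbMass r p i := fun i hi =>
    ((div_lt_iff₀ (hpos i)).mp (hN i hi)).le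
  -- `b` decreases to `0`, hence is nonnegative: this is the geometric tail bound without summing a
  -- series.
  let b : ℕ → ℝ := fun i => nbMass r p (i + N) - (1 - q) * (nb r p).real (Set.Ici (i + N))
  have hb : Antitone b := by
    refine antitone_nat_of_succ_le fun i => ?_
    have h1 := hratio (i + N) (by omega)
    have h2 := nb_real_Ici hr hp0 hp1 (i + N)
    simp only [b, add_right_comm i 1 N]
    rw [h2]
    linarith
  have hb0 : Tendsto b atTop (𝓝 0) := by
    have h := (((summable_nbMass hr hp0 hp1).tendsto_atTop_zero).sub
      ((tendsto_nb_real_Ici hr hp0 hp1).const_mul (1 - q))).comp (tendsto_add_atTop_nat N)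
    simpa [b, Function.comp_def] using h
  have htail : ∀ i, N ≤ i → (nb r p).real (Set.Ici i) / nbMass r p i ≤ 1 / (1 - q) := by
    intro i hi
    have h := hb.le_of_tendsto hb0 (i - N)
    simp only [b, Nat.sub_add_cancel hi] at h
    rw [div_le_div_iff₀ (hpos i) (by linarith)]
    linarith
  -- The finitely many indices below `N` only enlarge the constant.
  have hbdd : BddAbove (Set.range fun i : ℕ => (nb r p).real (Set.Ici i) / nbMass r p i) :=
    IsBoundedUnder.bddAbove_range
      ⟨1 / (1 - q), eventually_map.mpr (eventually_atTop.mpr ⟨N, htail⟩)⟩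
  obtain ⟨C, hC⟩ := hbdd
  exact ⟨C, fun i => (div_le_iff₀ (hpos i)).mp (hC ⟨i, rfl⟩)⟩

/-! ### The conditioned law and centred indicators. -/

theorem isProbabilityMeasure_nbCond {r p : ℝ} (hr : 0 < r) (hp0 : 0 < p) (hp1 : p < 1) (m : ℕ) :
    IsProbabilityMeasure (nbCond r p m) := by
  have := isFiniteMeasure_nb hr hp0 hp1
  refine cond_isProbabilityMeasure fun h => ?_
  have h1 := nb_real_Ici hr hp0 hp1 m
  have h2 := nbMass_pos hr hp0 hp1 m
  have h3 : 0 ≤ (nb r p).real (Set.Ici (m + 1)) := measureReal_nonneg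
  rw [measureReal_def, h, ENNReal.toReal_zero] at h1
  linarith

theorem mem_Icc_of_mem_indicators {m : ℕ} {f : ℕ → ℝ} (hf : f ∈ indicators m) (i : ℕ) :
    f i ∈ Set.Icc (0 : ℝ) 1 := by
  obtain ⟨A, -, rfl⟩ := hf
  by_cases h : i ∈ A <;> simp [h]

theorem integrable_of_mem_indicators {m : ℕ} {f : ℕ → ℝ} (hf : f ∈ indicators m)
    (ν : Measure ℕ) [IsFiniteMeasure ν] : Integrable f ν := by
  refine Integrable.of_bound (measurable_of_countable f).aestronglyMeasurable 1
    (Eventually.of_forall fun i => ?_)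
  have h := mem_Icc_of_mem_indicators hf i
  rw [Real.norm_of_nonneg h.1]
  exact h.2

theorem integral_mem_Icc_of_mem_indicators {m : ℕ} {f : ℕ → ℝ} (hf : f ∈ indicators m)
    (ν : Measure ℕ) [IsProbabilityMeasure ν] : ∫ x, f x ∂ν ∈ Set.Icc (0 : ℝ) 1 := by
  refine ⟨integral_nonneg fun i => (mem_Icc_of_mem_indicators hf i).1, ?_⟩
  have h := integral_mono (integrable_of_mem_indicators hf ν) (integrable_const (1 : ℝ))
    fun i => (mem_Icc_of_mem_indicators hf i).2
  simpa using h

theorem abs_sub_integral_le_one {m : ℕ} {f : ℕ → ℝ} (hf : f ∈ indicators m)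
    (ν : Measure ℕ) [IsProbabilityMeasure ν] (i : ℕ) : |f i - ∫ x, f x ∂ν| ≤ 1 := by
  have h1 := mem_Icc_of_mem_indicators hf i
  have h2 := integral_mem_Icc_of_mem_indicators hf ν
  exact abs_le.mpr ⟨by linarith [h1.1, h2.2], by linarith [h1.2, h2.1]⟩

theorem setIntegral_sub_integral_nbCond {r p : ℝ} (hr : 0 < r) (hp0 : 0 < p) (hp1 : p < 1)
    {m : ℕ} {f : ℕ → ℝ} (hf : f ∈ indicators m) :
    ∫ i in Set.Ici m, (f i - ∫ x, f x ∂(nbCond r p m)) ∂(nb r p) = 0 := by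
  have := isFiniteMeasure_nb hr hp0 hp1
  have := isProbabilityMeasure_nbCond hr hp0 hp1 m
  have h : ∫ i, (f i - ∫ x, f x ∂(nbCond r p m)) ∂(nbCond r p m) = 0 := by
    rw [integral_sub (integrable_of_mem_indicators hf _) (integrable_const _)]
    simp
  have hne : nb r p (Set.Ici m) ≠ 0 := by
    intro h0
    have h1 : nbCond r p m = 0 := cond_eq_zero_of_meas_eq_zero h0
    exact IsProbabilityMeasure.ne_zero (nbCond r p m) h1
  -- The centring constant is frozen so that unfolding `nbCond` affects only the outer integral.
  generalize (∫ x, f x ∂(nbCond r p m)) = c at h ⊢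
  rw [nbCond, ProbabilityTheory.cond, integral_smul_measure, smul_eq_mul] at h
  refine (mul_eq_zero.mp h).resolve_left ?_
  exact ENNReal.toReal_ne_zero.mpr
    ⟨ENNReal.inv_ne_zero.mpr (measure_ne_top _ _), ENNReal.inv_ne_top.mpr hne⟩

/-! ### Uniform bounds on the Stein solutions. -/

/-- The solution of the Stein equation as a tail integral. -/
theorem mul_steinSol_add_setIntegral {r p : ℝ} (hr : 0 < r) (hp0 : 0 < p) (hp1 : p < 1)
    {m : ℕ} {f : ℕ → ℝ} (hf : f ∈ indicators m) {i : ℕ} (hi : m ≤ i) :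
    i * nbMass r p i * steinSol r p m f i +
      ∫ j in Set.Ici i, (f j - ∫ x, f x ∂(nbCond r p m)) ∂(nb r p) = 0 := by
  have := isFiniteMeasure_nb hr hp0 hp1
  induction i, hi using Nat.le_induction with
  | base =>
    rw [steinSol_eq_zero r p m f le_rfl, setIntegral_sub_integral_nbCond hr hp0 hp1 hf]
    simp
  | succ i hi ih =>
    have hint : Integrable (fun j => f j - ∫ x, f x ∂(nbCond r p m)) (nb r p) :=
      (integrable_of_mem_indicators hf _).sub (integrable_const _)
    rw [Ici_eq_singleton_union i, setIntegral_union (disjoint_singleton_Ici_succ i)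
      measurableSet_Ici hint.integrableOn hint.integrableOn, integral_singleton,
      nb_real_singleton hr hp0 hp1, smul_eq_mul, ← steinOp_steinSol hr hp0 m f hi, steinOp] at ih
    -- At `i = m` the cut-off is harmless thanks to the normalisation.
    have hz : (if m < i then (i : ℝ) * steinSol r p m f i else 0) = i * steinSol r p m f i := by
      split_ifs with h
      · rfl
      · rw [steinSol_eq_zero r p m f (not_lt.mp h), mul_zero]
    rw [hz] at ih
    rw [succ_mul_nbMass_succ hr]
    linear_combination ih

theorem exists_abs_steinSol_le {r p : ℝ} (hr : 0 < r) (hp0 : 0 < p) (hp1 : p < 1) (m : ℕ) :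
    ∃ C : ℝ, ∀ f ∈ indicators m, ∀ i, |steinSol r p m f i| ≤ C := by
  have := isFiniteMeasure_nb hr hp0 hp1
  have := isProbabilityMeasure_nbCond hr hp0 hp1 m
  obtain ⟨C, hC⟩ := exists_nb_real_Ici_le hr hp0 hp1
  have hpos := nbMass_pos hr hp0 hp1
  have hC0 : 0 ≤ C := nonneg_of_mul_nonneg_left (measureReal_nonneg.trans (hC 0)) (hpos 0)
  refine ⟨C, fun f hf i => ?_⟩
  rcases le_or_gt i m with hi | hi
  · rwa [steinSol_eq_zero r p m f hi, abs_zero]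
  have h := mul_steinSol_add_setIntegral hr hp0 hp1 hf hi.le
  have hb : ‖∫ j in Set.Ici i, (f j - ∫ x, f x ∂(nbCond r p m)) ∂(nb r p)‖ ≤
      1 * (nb r p).real (Set.Ici i) :=
    norm_setIntegral_le_of_norm_le_const (measure_lt_top _ _)
      fun j _ => abs_sub_integral_le_one hf _ j
  -- The factor `i` in the tail formula can then be dropped, leaving a bound independent of `f` and
  -- `i`.
  have hi1 : (1 : ℝ) ≤ i := by exact_mod_cast (Nat.zero_le m).trans_lt hi
  rw [← neg_eq_of_add_eq_zero_right h, norm_neg, norm_mul, one_mul,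
    Real.norm_of_nonneg (mul_pos (by linarith) (hpos i)).le, Real.norm_eq_abs] at hb
  refine le_of_mul_le_mul_left ?_ (hpos i)
  calc nbMass r p i * |steinSol r p m f i|
      ≤ i * (nbMass r p i * |steinSol r p m f i|) :=
        le_mul_of_one_le_left (mul_nonneg (hpos i).le (abs_nonneg _)) hi1
    _ ≤ C * nbMass r p i := by rw [← mul_assoc]; exact hb.trans (hC i)
    _ = nbMass r p i * C := mul_comm _ _

theorem enorm_le_ofReal_of_abs_le {x C : ℝ} (h : |x| ≤ C) : ‖x‖ₑ ≤ ENNReal.ofReal C := by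
  rw [Real.enorm_eq_ofReal_abs]
  exact ENNReal.ofReal_le_ofReal h

theorem steinFactor₁_ne_top {r p : ℝ} (hr : 0 < r) (hp0 : 0 < p) (hp1 : p < 1) (m : ℕ) :
    steinFactor₁ r p m ≠ ⊤ := by
  obtain ⟨C, hC⟩ := exists_abs_steinSol_le hr hp0 hp1 m
  refine ne_top_of_le_ne_top (ENNReal.ofReal_ne_top (r := C)) ?_
  exact iSup₂_le fun f hf => iSup₂_le fun w _ => enorm_le_ofReal_of_abs_le (hC f hf (w + 1))

theorem steinFactor₂_ne_top {r p : ℝ} (hr : 0 < r) (hp0 : 0 < p) (hp1 : p < 1) (m : ℕ) :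
    steinFactor₂ r p m ≠ ⊤ := by
  obtain ⟨C, hC⟩ := exists_abs_steinSol_le hr hp0 hp1 m
  refine ne_top_of_le_ne_top (ENNReal.ofReal_ne_top (r := C + C)) ?_
  exact iSup₂_le fun f hf => iSup₂_le fun w _ => enorm_le_ofReal_of_abs_le
    ((abs_sub _ _).trans (add_le_add (hC f hf (w + 1)) (hC f hf w)))

theorem steinFactor₂'_le_steinFactor₂ (r p : ℝ) (m : ℕ) :
    steinFactor₂' r p m ≤ steinFactor₂ r p m :=
  iSup₂_mono fun f _ => iSup₂_le fun w hw =>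
    le_iSup₂ (f := fun v (_ : v ∈ Set.Ici m) => ‖delta (steinSol r p m f) v‖ₑ) (w + 1)
      (Nat.le_succ_of_le hw)

theorem shiftNorm_zero_steinSol_le (r p : ℝ) {m : ℕ} {f : ℕ → ℝ} (hf : f ∈ indicators m) :
    shiftNorm 0 (steinSol r p m f) ≤ steinFactor₁ r p m := by
  refine le_trans ?_ (le_iSup₂ (f := fun f (_ : f ∈ indicators m) =>
    shiftNorm m (steinSol r p m f)) f hf)
  refine iSup₂_le fun w _ => ?_
  rcases lt_or_ge w m with hw | hw
  · simp [steinSol_eq_zero r p m f hw]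
  · exact le_iSup₂ (f := fun v (_ : v ∈ Set.Ici m) => ‖steinSol r p m f (v + 1)‖ₑ) w hw

/-- For `m ≥ 1` the norm on the left sees the jump of the zero extension between `m` and `m + 1`;
this is why `steinFactor₂` must include the difference at `w = m`. -/
theorem shiftNorm_zero_delta_steinSol_le (r p : ℝ) {m : ℕ} {f : ℕ → ℝ} (hf : f ∈ indicators m) :
    shiftNorm 0 (delta (steinSol r p m f)) ≤ steinFactor₂ r p m := by
  refine le_trans ?_ (le_iSup₂ (f := fun f (_ : f ∈ indicators m) =>
    ⨆ w ∈ Set.Ici m, ‖delta (steinSol r p m f) w‖ₑ) f hf)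
  refine iSup₂_le fun w _ => ?_
  rcases lt_or_ge (w + 1) m with hw | hw
  · simp [delta, steinSol_eq_zero r p m f hw, steinSol_eq_zero r p m f hw.le]
  · exact le_iSup₂ (f := fun v (_ : v ∈ Set.Ici m) => ‖delta (steinSol r p m f) v‖ₑ) (w + 1) hw

/-! ### Transfer to the conditional law of `W`. -/

/-- Extended by zero, the solution of the truncated Stein equation solves the untruncated one with
right-hand side vanishing below `m`. -/
theorem steinOp_zero_steinSol {r p : ℝ} (hr : 0 < r) (hp0 : 0 < p) (m : ℕ) (f : ℕ → ℝ) (i : ℕ) :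
    steinOp r p 0 (steinSol r p m f) i =
      (Set.Ici m).indicator (fun i => f i - ∫ x, f x ∂(nbCond r p m)) i := by
  by_cases hi : i ∈ Set.Ici m
  · rw [Set.indicator_of_mem hi, ← steinOp_steinSol hr hp0 m f hi, steinOp, steinOp]
    congr 1
    by_cases h : m < i
    · rw [if_pos h, if_pos (by omega)]
    · rw [if_neg h, steinSol_eq_zero r p m f (not_lt.mp h), mul_zero, ite_self]
  · rw [Set.indicator_of_notMem hi]
    have hi' : i < m := not_le.mp hi
    simp [steinOp, steinSol_eq_zero r p m f hi'.le, steinSol_eq_zero r p m f hi']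

theorem integral_condLaw_sub {Ω : Type*} [MeasurableSpace Ω] (μ : Measure Ω)
    [IsProbabilityMeasure μ] {W : Ω → ℕ} (hW : Measurable W) {r p : ℝ} (hr : 0 < r) (hp0 : 0 < p)
    {m : ℕ} (hm : 0 < μ.real {ω | m ≤ W ω}) {f : ℕ → ℝ} (hf : f ∈ indicators m) :
    ∫ x, f x ∂(condLaw μ W m) - ∫ x, f x ∂(nbCond r p m) =
      (∫ ω, steinOp r p 0 (steinSol r p m f) (W ω) ∂μ) / μ.real {ω | m ≤ W ω} := by
  have hs : MeasurableSet {ω | m ≤ W ω} := hW measurableSet_Ici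
  have hne : μ {ω | m ≤ W ω} ≠ 0 := fun h => by simp [measureReal_def, h] at hm
  have := cond_isProbabilityMeasure hne
  have hprob : IsProbabilityMeasure (condLaw μ W m) :=
    Measure.isProbabilityMeasure_map hW.aemeasurable
  simp_rw [steinOp_zero_steinSol hr hp0 m f]
  generalize (∫ x, f x ∂(nbCond r p m)) = c
  have h1 : ∫ x, f x ∂(condLaw μ W m) - c = ∫ x, (f x - c) ∂(condLaw μ W m) := by
    rw [integral_sub (integrable_of_mem_indicators hf _) (integrable_const _)]
    simp
  have h2 : (fun ω => (Set.Ici m).indicator (fun i => f i - c) (W ω)) =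
      {ω | m ≤ W ω}.indicator fun ω => f (W ω) - c := rfl
  rw [h1, condLaw, integral_map hW.aemeasurable (measurable_of_countable _).aestronglyMeasurable,
    ProbabilityTheory.cond, integral_smul_measure, h2, integral_indicator hs, smul_eq_mul,
    ENNReal.toReal_inv, ← measureReal_def, div_eq_inv_mul]

/-- The operator has unbounded coefficients, but on a Stein solution it is bounded by `1`, so no
moment of `W` is needed. -/
theorem integrable_steinOp_steinSol {Ω : Type*} [MeasurableSpace Ω] (μ : Measure Ω)
    [IsProbabilityMeasure μ] {W : Ω → ℕ} (hW : Measurable W) {r p : ℝ} (hr : 0 < r) (hp0 : 0 < p)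
    (hp1 : p < 1) {m : ℕ} {f : ℕ → ℝ} (hf : f ∈ indicators m) :
    Integrable (fun ω => steinOp r p 0 (steinSol r p m f) (W ω)) μ := by
  have := isProbabilityMeasure_nbCond hr hp0 hp1 m
  refine Integrable.of_bound
    ((measurable_of_countable (steinOp r p 0 (steinSol r p m f))).comp hW).aestronglyMeasurable 1
    (Eventually.of_forall fun ω => ?_)
  rw [steinOp_zero_steinSol hr hp0]
  exact (norm_indicator_le_norm_self _ _).trans (abs_sub_integral_le_one hf _ _)

theorem dTV_le {m : ℕ} {Q₁ Q₂ : Measure ℕ} {B : ℝ}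
    (h : ∀ f ∈ indicators m, |∫ x, f x ∂Q₁ - ∫ x, f x ∂Q₂| ≤ B) : dTV m Q₁ Q₂ ≤ B := by
  have : Nonempty (indicators m) := ⟨⟨_, ∅, Set.empty_subset _, rfl⟩⟩
  exact ciSup_le fun f => h f.1 f.2

/-- Stein's method bound, with any finite bound `G` on the differences of the solutions. -/
theorem dTV_condLaw_nbCond_le {Ω : Type*} [MeasurableSpace Ω] (μ : Measure Ω)
    [IsProbabilityMeasure μ] {W : Ω → ℕ} (hW : Measurable W) {r p : ℝ} (hr : 0 < r) (hp0 : 0 < p)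
    (hp1 : p < 1) {ε₁ ε₂ : ℝ} (hε₁ : 0 ≤ ε₁) (hε₂ : 0 ≤ ε₂)
    (happrox : ∀ g : ℕ → ℝ, shiftNorm 0 g ≠ ⊤ → shiftNorm 0 (delta g) ≠ ⊤ →
      Integrable (fun ω => steinOp r p 0 g (W ω)) μ →
      |∫ ω, steinOp r p 0 g (W ω) ∂μ| ≤
        ε₁ * (shiftNorm 0 g).toReal + ε₂ * (shiftNorm 0 (delta g)).toReal)
    {m : ℕ} (hm : 0 < μ.real {ω | m ≤ W ω}) {G : ℝ≥0∞} (hG : G ≠ ⊤)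
    (hle : ∀ f ∈ indicators m, shiftNorm 0 (delta (steinSol r p m f)) ≤ G) :
    dTV m (condLaw μ W m) (nbCond r p m) ≤
      (ε₁ * (steinFactor₁ r p m).toReal + ε₂ * G.toReal) / μ.real {ω | m ≤ W ω} := by
  refine dTV_le fun f hf => ?_
  have hG₁ := steinFactor₁_ne_top hr hp0 hp1 m
  have h₁ := shiftNorm_zero_steinSol_le r p hf
  rw [integral_condLaw_sub μ hW hr hp0 hm hf, abs_div, abs_of_pos hm]
  refine div_le_div_of_nonneg_right ?_ hm.le
  refine (happrox _ (ne_top_of_le_ne_top hG₁ h₁) (ne_top_of_le_ne_top hG (hle f hf))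
    (integrable_steinOp_steinSol μ hW hr hp0 hp1 hf)).trans ?_
  exact add_le_add
    (mul_le_mul_of_nonneg_left (ENNReal.toReal_mono hG₁ h₁) hε₁)
    (mul_le_mul_of_nonneg_left (ENNReal.toReal_mono hG (hle f hf)) hε₂)

end CondNB

theorem mainTheorem6 {Ω : Type*} [MeasurableSpace Ω] (μ : Measure Ω) [IsProbabilityMeasure μ]
    (W : Ω → ℕ) (hW : Measurable W) (r p : ℝ) (hr : 0 < r) (hp0 : 0 < p) (hp1 : p < 1)
    (ε₁ ε₂ : ℝ) (hε₁ : 0 < ε₁) (hε₂ : 0 < ε₂)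
    (happrox : ∀ g : ℕ → ℝ, CondNB.shiftNorm 0 g ≠ ⊤ → CondNB.shiftNorm 0 (CondNB.delta g) ≠ ⊤ →
      Integrable (fun ω => CondNB.steinOp r p 0 g (W ω)) μ →
      |∫ ω, CondNB.steinOp r p 0 g (W ω) ∂μ| ≤
        ε₁ * (CondNB.shiftNorm 0 g).toReal + ε₂ * (CondNB.shiftNorm 0 (CondNB.delta g)).toReal)
    (m : ℕ) (hm : 0 < μ.real {ω | m ≤ W ω}) :
    CondNB.steinFactor₁ r p m ≠ ⊤ ∧ CondNB.steinFactor₂ r p m ≠ ⊤ ∧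
    CondNB.dTV m (CondNB.condLaw μ W m) (CondNB.nbCond r p m) ≤
      (ε₁ * (CondNB.steinFactor₁ r p m).toReal + ε₂ * (CondNB.steinFactor₂ r p m).toReal) /
        μ.real {ω | m ≤ W ω} ∧
    (m = 0 →
      CondNB.dTV m (CondNB.condLaw μ W m) (CondNB.nbCond r p m) ≤
        (ε₁ * (CondNB.steinFactor₁ r p m).toReal + ε₂ * (CondNB.steinFactor₂' r p m).toReal) /
          μ.real {ω | m ≤ W ω}) := by
  have hG₂ := CondNB.steinFactor₂_ne_top hr hp0 hp1 m
  refine ⟨CondNB.steinFactor₁_ne_top hr hp0 hp1 m, hG₂,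
    CondNB.dTV_condLaw_nbCond_le μ hW hr hp0 hp1 hε₁.le hε₂.le happrox hm hG₂
      fun f hf => CondNB.shiftNorm_zero_delta_steinSol_le r p hf, ?_⟩
  -- For `m = 0` the norm in the hypothesis already skips the difference at `0`, so `steinFactor₂'`
  -- bounds it by definition.
  rintro rfl
  exact CondNB.dTV_condLaw_nbCond_le μ hW hr hp0 hp1 hε₁.le hε₂.le happrox hm
    (ne_top_of_le_ne_top hG₂ (CondNB.steinFactor₂'_le_steinFactor₂ r p 0))
    fun f hf => le_iSup₂ (f := fun f (_ : f ∈ CondNB.indicators 0) =>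
      CondNB.shiftNorm 0 (CondNB.delta (CondNB.steinSol r p 0 f))) f hf
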